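/- Let $k$ be a commutative ring (algebras are associative and unital unless called nonunital), and let $A_1$ and $A_2$ be $k$-algebras such that (i) the structure map $k\to A_1$ has a left inverse $\pi:A_1\to k$ as a map of $k$-modules; put $M_1=\ker\pi$; and (ii) there is a surjective $k$-algebra homomorphism $\psi:A_2\to k[x]/(x^3)$. Write $x$ also for a fixed element of $A_2$ which $\psi$ sends to the class of $x$. Let $B=A_1\amalg A_2$ be the coproduct (free product) of $A_1$ and $A_2$ as $k$-algebras, and write $a$ also for the image in $B$ of an element $a$ of $A_1$ or $A_2$. Then: (1) the map $m\mapsto x\,m\,x$ is an isomorphism of $k$-modules from $M_1$ onto the submodule $x\,M_1\,x$ of $B$; (2) the nonunital $k$-subalgebra $A$ of $B$ generated by $x\,M_1\,x$ is isomorphic, by the homomorphism extending $m\mapsto x\,m\,x$, to the nonunital tensor algebra $\bigoplus_{n\ge 1}M_1^{\otimes n}$ on $M_1$; (3) $A$ has the ideal extension property in $B$: every two-sided $k$-algebra ideal of $A$ is the intersection of $A$ with a two-sided ideal of $B$. (4) Hence, if $A_0$ is a $k$-algebra which admits a $k$-algebra homomorphism to $k$ and which is generated as a $k$-algebra by the image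 of a $k$-module homomorphism $M_1\to A_0$, then there are a $k$-algebra $R$ and injective $k$-algebra homomorphisms $A_0\to R$, $A_1\to R$, $A_2\to R$ such that $R$ is generated as a $k$-algebra by the images of $A_1$ and $A_2$. -/

import Mathlib

universe u v w z

section Coproduct

variable (k : Type u) [CommRing k] (A₁ : Type v) [Ring A₁] [Algebra k A₁]
  (A₂ : Type w) [Ring A₂] [Algebra k A₂]

/-- The relations which turn the two summands of `A₁ × A₂`, inside the tensor algebra of this
module, into unital algebra images of `A₁` and `A₂`. -/
inductive AlgCoprod.Rel : TensorAlgebra k (A₁ × A₂) → TensorAlgebra k (A₁ × A₂) → Prop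
  | one_left : AlgCoprod.Rel (TensorAlgebra.ι k ((1 : A₁), (0 : A₂))) 1
  | one_right : AlgCoprod.Rel (TensorAlgebra.ι k ((0 : A₁), (1 : A₂))) 1
  | mul_left (a b : A₁) : AlgCoprod.Rel (TensorAlgebra.ι k (a * b, (0 : A₂)))
      (TensorAlgebra.ι k (a, (0 : A₂)) * TensorAlgebra.ι k (b, (0 : A₂)))
  | mul_right (a b : A₂) : AlgCoprod.Rel (TensorAlgebra.ι k ((0 : A₁), a * b))
      (TensorAlgebra.ι k ((0 : A₁), a) * TensorAlgebra.ι k ((0 : A₁), b))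

/-- The coproduct ("free product") of two unital associative `k`-algebras. Its universal property
is given by `AlgCoprod.lift`, `AlgCoprod.lift_inl`, `AlgCoprod.lift_inr`, `AlgCoprod.hom_ext`. -/
abbrev AlgCoprod : Type (max u v w) := RingQuot (AlgCoprod.Rel k A₁ A₂)

namespace AlgCoprod

/-- The coprojection of the first factor. -/
noncomputable def inl : A₁ →ₐ[k] AlgCoprod k A₁ A₂ :=
  AlgHom.ofLinearMap
    ((RingQuot.mkAlgHom k (Rel k A₁ A₂)).toLinearMap ∘ₗ TensorAlgebra.ι k ∘ₗ
      LinearMap.inl k A₁ A₂)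
    (by
      simpa using RingQuot.mkAlgHom_rel k (Rel.one_left (k := k) (A₁ := A₁) (A₂ := A₂)))
    (fun a b => by
      simpa using RingQuot.mkAlgHom_rel k (Rel.mul_left (k := k) (A₁ := A₁) (A₂ := A₂) a b))

/-- The coprojection of the second factor. -/
noncomputable def inr : A₂ →ₐ[k] AlgCoprod k A₁ A₂ :=
  AlgHom.ofLinearMap
    ((RingQuot.mkAlgHom k (Rel k A₁ A₂)).toLinearMap ∘ₗ TensorAlgebra.ι k ∘ₗ
      LinearMap.inr k A₁ A₂)
    (by
      simpa using RingQuot.mkAlgHom_rel k (Rel.one_right (k := k) (A₁ := A₁) (A₂ := A₂)))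
    (fun a b => by
      simpa using RingQuot.mkAlgHom_rel k (Rel.mul_right (k := k) (A₁ := A₁) (A₂ := A₂) a b))

variable {k A₁ A₂} {C : Type z} [Ring C] [Algebra k C]

/-- The homomorphism out of the coproduct given by a homomorphism on each factor. -/
noncomputable def lift (f : A₁ →ₐ[k] C) (g : A₂ →ₐ[k] C) : AlgCoprod k A₁ A₂ →ₐ[k] C :=
  RingQuot.liftAlgHom k
    ⟨TensorAlgebra.lift k (f.toLinearMap.coprod g.toLinearMap), by
      intro p q h
      cases h <;> simp⟩

theorem lift_inl (f : A₁ →ₐ[k] C) (g : A₂ →ₐ[k] C) (a : A₁) :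
    lift f g (inl k A₁ A₂ a) = f a := by
  simp [lift, inl]

theorem lift_inr (f : A₁ →ₐ[k] C) (g : A₂ →ₐ[k] C) (a : A₂) :
    lift f g (inr k A₁ A₂ a) = g a := by
  simp [lift, inr]

theorem hom_ext {f g : AlgCoprod k A₁ A₂ →ₐ[k] C}
    (h₁ : ∀ a, f (inl k A₁ A₂ a) = g (inl k A₁ A₂ a))
    (h₂ : ∀ a, f (inr k A₁ A₂ a) = g (inr k A₁ A₂ a)) : f = g := by
  apply RingQuot.ringQuot_ext'
  apply TensorAlgebra.hom_ext
  apply LinearMap.prod_ext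
  · ext a
    exact h₁ a
  · ext a
    exact h₂ a

end AlgCoprod

end Coproduct

/-- The nonunital tensor algebra of a `k`-module `M`: the nonunital subalgebra of the tensor
algebra generated by `M`, that is, the direct sum of the tensor powers of `M` of exponent at
least `1`. -/
noncomputable def nonUnitalTensorAlgebra (k : Type u) [CommRing k] (M : Type v)
    [AddCommGroup M] [Module k M] : NonUnitalSubalgebra k (TensorAlgebra k M) :=
  NonUnitalAlgebra.adjoin k (Set.range (TensorAlgebra.ι k : M →ₗ[k] TensorAlgebra k M))

/-- The inclusion of `M` in its nonunital tensor algebra. -/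
noncomputable def nonUnitalTensorAlgebra.of (k : Type u) [CommRing k] {M : Type v}
    [AddCommGroup M] [Module k M] (m : M) : nonUnitalTensorAlgebra k M :=
  ⟨TensorAlgebra.ι k m, NonUnitalAlgebra.subset_adjoin k ⟨m, rfl⟩⟩

/-- A `k`-submodule of a (not necessarily unital) `k`-algebra is a (two-sided) ideal if it absorbs
multiplication on both sides. -/
def IsAlgIdeal {k : Type u} [CommRing k] {R : Type v} [NonUnitalRing R] [Module k R]
    (I : Submodule k R) : Prop :=
  ∀ r : R, ∀ b ∈ I, r * b ∈ I ∧ b * r ∈ I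

/-- A nonunital subalgebra `A` of `B` has the ideal extension property if every ideal of `A` is
the intersection of `A` with an ideal of `B`. -/
def HasIdealExtensionProperty {k : Type u} [CommRing k] {B : Type v} [NonUnitalRing B]
    [Module k B] (A : NonUnitalSubalgebra k B) : Prop :=
  ∀ I : Submodule k A, IsAlgIdeal I →
    ∃ J : Submodule k B, IsAlgIdeal J ∧ ∀ a : A, a ∈ I ↔ (a : B) ∈ J

/-- The `k`-linear map `b ↦ x b x`. -/
def sandwich (k : Type u) [CommRing k] {B : Type v} [Ring B] [Algebra k B] (x : B) :
    B →ₗ[k] B :=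
  LinearMap.mulLeft k x ∘ₗ LinearMap.mulRight k x

/-- The `k`-submodule `x M x` of the coproduct of `A₁` and `A₂`, for a submodule `M` of `A₁` and
an element `x` of `A₂`. -/
noncomputable def sandwichSubmodule {k : Type u} [CommRing k] {A₁ : Type v} [Ring A₁]
    [Algebra k A₁] {A₂ : Type w} [Ring A₂] [Algebra k A₂] (M : Submodule k A₁) (x : A₂) :
    Submodule k (AlgCoprod k A₁ A₂) :=
  (M.map (AlgCoprod.inl k A₁ A₂).toLinearMap).map (sandwich k (AlgCoprod.inr k A₁ A₂ x))

/-- The nonunital subalgebra of the coproduct of `A₁` and `A₂` generated by `x M x`. -/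
noncomputable def sandwichSubalgebra {k : Type u} [CommRing k] {A₁ : Type v} [Ring A₁]
    [Algebra k A₁] {A₂ : Type w} [Ring A₂] [Algebra k A₂] (M : Submodule k A₁) (x : A₂) :
    NonUnitalSubalgebra k (AlgCoprod k A₁ A₂) :=
  NonUnitalAlgebra.adjoin k (sandwichSubmodule M x : Set (AlgCoprod k A₁ A₂))

/-! Every module `N` over the tensor algebra `T` of `M₁` embeds in a `B`-module so that `m` acts on
`N` as `x m x`. Since `A₁ = k ⊕ M₁`, let `A₁` act on `(A₁ ⊗ N) ^ 2` by left multiplication, and let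
`x` carry `1 ⊗ n` from the first copy to the second and `m ⊗ n` in the second copy to `1 ⊗ f m n` in
the first. This operator has cube zero, so `A₂` acts through `ψ`. The action of all of `T` is
computed in `shiftRep_sandwichHom`.

Taking `N = T` gives freeness, hence (1) and (2). Taking `N = T / I` gives an action whose kernel
meets `A` in `I`, hence (3).

For (4), `R` is `B` modulo the image of the kernel of a surjection `T → A₀`, and `N = A₀` shows that
`A₀` embeds. A second representation, `augmentedRep`, kills `x M₁ x` yet is faithful on `A₁` and on
`A₂`, so these embed too. -/

open scoped TensorProduct

/-! ### Two representations of the coproduct -/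

section Action

variable {k : Type*} [CommRing k] {A₁ : Type*} [Ring A₁] [Algebra k A₁]

/-- The projection of an algebra onto the kernel of a linear retraction `π` of its structure
map. -/
def kerProjection (π : A₁ →ₗ[k] k) (hπ : ∀ c : k, π (algebraMap k A₁ c) = c) :
    A₁ →ₗ[k] LinearMap.ker π :=
  (LinearMap.id - (Algebra.linearMap k A₁) ∘ₗ π).codRestrict (LinearMap.ker π)
    fun a => by simp [hπ]

theorem kerProjection_one (π : A₁ →ₗ[k] k) (hπ : ∀ c : k, π (algebraMap k A₁ c) = c) :
    kerProjection π hπ 1 = 0 := by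
  have h : π 1 = 1 := by simpa using hπ 1
  exact Subtype.ext (show 1 - algebraMap k A₁ (π 1) = 0 by simp [h])

theorem kerProjection_coe (π : A₁ →ₗ[k] k) (hπ : ∀ c : k, π (algebraMap k A₁ c) = c)
    (m : LinearMap.ker π) : kerProjection π hπ m = m := by
  exact Subtype.ext (show (m : A₁) - algebraMap k A₁ (π m) = m by simp)

/-- The homomorphism from `k[X] / (X ^ 3)` given by an element of cube zero. -/
noncomputable def truncatedAeval {E : Type*} [Ring E] [Algebra k E] (y : E) (hy : y ^ 3 = 0) :
    (Polynomial k ⧸ Ideal.span {(Polynomial.X : Polynomial k) ^ 3}) →ₐ[k] E :=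
  Ideal.Quotient.liftₐ _ (Polynomial.aeval y) (by
    intro a ha
    obtain ⟨c, rfl⟩ := Ideal.mem_span_singleton.1 ha
    simp [hy])

theorem truncatedAeval_mk_X {E : Type*} [Ring E] [Algebra k E] (y : E) (hy : y ^ 3 = 0) :
    truncatedAeval (k := k) y hy (Ideal.Quotient.mk _ Polynomial.X) = y :=
  Polynomial.aeval_X y

variable {N : Type*} [AddCommGroup N] [Module k N]

/-- The map `n ↦ 1 ⊗ n`. -/
noncomputable def oneTensor (k A₁ N : Type*) [CommRing k] [Ring A₁] [Algebra k A₁]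
    [AddCommGroup N] [Module k N] : N →ₗ[k] A₁ ⊗[k] N :=
  TensorProduct.mk k A₁ N 1

/-- The map `a ⊗ n ↦ π a • n`. -/
noncomputable def leftContract (N : Type*) [AddCommGroup N] [Module k N] (π : A₁ →ₗ[k] k) :
    A₁ ⊗[k] N →ₗ[k] N :=
  TensorProduct.lift (LinearMap.lsmul k N ∘ₗ π)

theorem leftContract_oneTensor (π : A₁ →ₗ[k] k) (hπ : ∀ c : k, π (algebraMap k A₁ c) = c)
    (n : N) : leftContract N π (oneTensor k A₁ N n) = n := by
  have h : π 1 = 1 := by simpa using hπ 1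
  simp [leftContract, oneTensor, h]

theorem leftContract_smul_oneTensor (π : A₁ →ₗ[k] k) (m : LinearMap.ker π) (n : N) :
    leftContract N π ((m : A₁) • oneTensor k A₁ N n) = 0 := by
  simp [leftContract, oneTensor, TensorProduct.smul_tmul']

/-- The map `a ⊗ n ↦ f (a - π a) n`, for a linear map `f` from `ker π` to the endomorphisms
of `N`. -/
noncomputable def kerContract (π : A₁ →ₗ[k] k) (hπ : ∀ c : k, π (algebraMap k A₁ c) = c)
    (f : LinearMap.ker π →ₗ[k] Module.End k N) : A₁ ⊗[k] N →ₗ[k] N :=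
  TensorProduct.lift (f ∘ₗ kerProjection π hπ)

theorem kerContract_oneTensor (π : A₁ →ₗ[k] k) (hπ : ∀ c : k, π (algebraMap k A₁ c) = c)
    (f : LinearMap.ker π →ₗ[k] Module.End k N) (n : N) :
    kerContract π hπ f (oneTensor k A₁ N n) = 0 := by
  simp [kerContract, oneTensor, kerProjection_one]

theorem kerContract_smul_oneTensor (π : A₁ →ₗ[k] k) (hπ : ∀ c : k, π (algebraMap k A₁ c) = c)
    (f : LinearMap.ker π →ₗ[k] Module.End k N) (m : LinearMap.ker π) (n : N) :
    kerContract π hπ f ((m : A₁) • oneTensor k A₁ N n) = f m n := by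
  simp [kerContract, oneTensor, TensorProduct.smul_tmul', kerProjection_coe]

/-- The endomorphism `(u, v) ↦ (1 ⊗ μ v, 1 ⊗ p u)` of `(A₁ ⊗ N) ^ 2`, where `p (a ⊗ n) = π a • n`
and `μ (a ⊗ n) = f (a - π a) n`. -/
noncomputable def shiftEnd (π : A₁ →ₗ[k] k) (hπ : ∀ c : k, π (algebraMap k A₁ c) = c)
    (f : LinearMap.ker π →ₗ[k] Module.End k N) :
    Module.End k ((A₁ ⊗[k] N) × (A₁ ⊗[k] N)) :=
  (oneTensor k A₁ N ∘ₗ kerContract π hπ f ∘ₗ LinearMap.snd k _ _).prod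
    (oneTensor k A₁ N ∘ₗ leftContract N π ∘ₗ LinearMap.fst k _ _)

theorem shiftEnd_apply (π : A₁ →ₗ[k] k) (hπ : ∀ c : k, π (algebraMap k A₁ c) = c)
    (f : LinearMap.ker π →ₗ[k] Module.End k N) (u v : A₁ ⊗[k] N) :
    shiftEnd π hπ f (u, v) =
      (oneTensor k A₁ N (kerContract π hπ f v), oneTensor k A₁ N (leftContract N π u)) :=
  rfl

/-- In each component of the cube, `μ` is applied to some `1 ⊗ n`, where it vanishes because `1` has
no component in `ker π`. -/
theorem shiftEnd_pow_three (π : A₁ →ₗ[k] k) (hπ : ∀ c : k, π (algebraMap k A₁ c) = c)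
    (f : LinearMap.ker π →ₗ[k] Module.End k N) : shiftEnd π hπ f ^ 3 = 0 := by
  refine LinearMap.ext fun ⟨u, v⟩ => ?_
  simp [pow_succ, shiftEnd_apply, kerContract_oneTensor]

variable {A₂ : Type*} [Ring A₂] [Algebra k A₂]

/-- The representation of the coproduct on `(A₁ ⊗ N) ^ 2` in which `A₁` acts by left
multiplication and `A₂` acts through `k[X] / (X ^ 3)`, with `X` acting as `shiftEnd`. -/
noncomputable def shiftRep (π : A₁ →ₗ[k] k) (hπ : ∀ c : k, π (algebraMap k A₁ c) = c)
    (ψ : A₂ →ₐ[k] Polynomial k ⧸ Ideal.span {(Polynomial.X : Polynomial k) ^ 3})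
    (f : LinearMap.ker π →ₗ[k] Module.End k N) :
    AlgCoprod k A₁ A₂ →ₐ[k] Module.End k ((A₁ ⊗[k] N) × (A₁ ⊗[k] N)) :=
  AlgCoprod.lift (Algebra.lsmul k k _)
    ((truncatedAeval (shiftEnd π hπ f) (shiftEnd_pow_three π hπ f)).comp ψ)

/-- The homomorphism from the tensor algebra on `M` to the coproduct which extends
`m ↦ x * m * x`. -/
noncomputable def sandwichHom (M : Submodule k A₁) (x : A₂) :
    TensorAlgebra k M →ₐ[k] AlgCoprod k A₁ A₂ :=
  TensorAlgebra.lift k (sandwich k (AlgCoprod.inr k A₁ A₂ x) ∘ₗ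
    (AlgCoprod.inl k A₁ A₂).toLinearMap ∘ₗ M.subtype)

theorem sandwichHom_ι (M : Submodule k A₁) (x : A₂) (m : M) :
    sandwichHom M x (TensorAlgebra.ι k m) =
      AlgCoprod.inr k A₁ A₂ x * AlgCoprod.inl k A₁ A₂ m * AlgCoprod.inr k A₁ A₂ x := by
  simp [sandwichHom, sandwich, mul_assoc]

/-- An element `t` of the tensor algebra acts as `F t` on `1 ⊗ N` in the first summand, and
through the augmentation on a complement. -/
theorem shiftRep_sandwichHom (π : A₁ →ₗ[k] k) (hπ : ∀ c : k, π (algebraMap k A₁ c) = c)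
    (ψ : A₂ →ₐ[k] Polynomial k ⧸ Ideal.span {(Polynomial.X : Polynomial k) ^ 3})
    (x : A₂) (hx : ψ x = Ideal.Quotient.mk _ (Polynomial.X : Polynomial k))
    (F : TensorAlgebra k (LinearMap.ker π) →ₐ[k] Module.End k N)
    (t : TensorAlgebra k (LinearMap.ker π)) (u v : A₁ ⊗[k] N) :
    shiftRep π hπ ψ (F.toLinearMap ∘ₗ TensorAlgebra.ι k) (sandwichHom (LinearMap.ker π) x t)
        (u, v) =
      (oneTensor k A₁ N (F t (leftContract N π u)) +
        TensorAlgebra.algebraMapInv t • (u - oneTensor k A₁ N (leftContract N π u)),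
      TensorAlgebra.algebraMapInv t • v) := by
  induction t using TensorAlgebra.induction generalizing u v with
  | algebraMap r =>
    simp only [AlgHom.commutes, Module.algebraMap_end_apply, Prod.smul_mk, map_smul]
    simp [smul_sub]
  | ι m =>
    have h : TensorAlgebra.algebraMapInv (TensorAlgebra.ι k m) = (0 : k) := by
      simp [TensorAlgebra.algebraMapInv]
    rw [sandwichHom_ι]
    -- After `x` and `m`, the pair is `(m ⊗ μ v, m ⊗ p u)`; the last `x` turns `m ⊗ p u` into `1 ⊗ f
    -- m (p u)` and kills `m ⊗ μ v`, as `π m = 0`.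
    simp [shiftRep, AlgCoprod.lift_inl, AlgCoprod.lift_inr, hx, truncatedAeval_mk_X,
      shiftEnd_apply, kerContract_smul_oneTensor, leftContract_smul_oneTensor, h]
  | mul s t hs ht =>
    simp only [map_mul, Module.End.mul_apply, ht, hs]
    simp [leftContract_oneTensor π hπ, smul_smul]
  | add s t hs ht =>
    simp only [map_add, LinearMap.add_apply, hs, ht, Prod.mk_add_mk, add_smul]
    congr 1
    abel

/-- The endomorphism of `A₁ ⊗ A₂` by which `b` acts: left multiplication on `1 ⊗ A₂`, and
the augmentation `ε` on `ker π ⊗ A₂`. -/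
noncomputable def augmentedMul (π : A₁ →ₗ[k] k) (hπ : ∀ c : k, π (algebraMap k A₁ c) = c)
    (ε : A₂ →ₐ[k] k) : A₂ →ₐ[k] Module.End k (A₁ ⊗[k] A₂) :=
  AlgHom.ofLinearMap
    (LinearMap.mk₂ k
      (fun b u => oneTensor k A₁ A₂ (b * leftContract A₂ π u) +
        ε b • (u - oneTensor k A₁ A₂ (leftContract A₂ π u)))
      (fun b c u => by simp only [add_mul, map_add, add_smul]; abel)
      (fun r b u => by simp [mul_smul])
      (fun b u v => by simp only [mul_add, map_add, smul_sub, smul_add]; abel)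
      (fun r b u => by simp [smul_sub, smul_comm r (ε b)]))
    (by ext; simp)
    (fun b c => by
      refine LinearMap.ext fun u => ?_
      simp [leftContract_oneTensor π hπ, smul_smul, mul_assoc])

theorem augmentedMul_apply (π : A₁ →ₗ[k] k) (hπ : ∀ c : k, π (algebraMap k A₁ c) = c)
    (ε : A₂ →ₐ[k] k) (b : A₂) (u : A₁ ⊗[k] A₂) :
    augmentedMul π hπ ε b u = oneTensor k A₁ A₂ (b * leftContract A₂ π u) +
      ε b • (u - oneTensor k A₁ A₂ (leftContract A₂ π u)) :=
  rfl

/-- The representation of the coproduct on `A₁ ⊗ A₂` in which `A₁` acts by left multiplication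
and `A₂` by `augmentedMul`. -/
noncomputable def augmentedRep (π : A₁ →ₗ[k] k) (hπ : ∀ c : k, π (algebraMap k A₁ c) = c)
    (ε : A₂ →ₐ[k] k) : AlgCoprod k A₁ A₂ →ₐ[k] Module.End k (A₁ ⊗[k] A₂) :=
  AlgCoprod.lift (Algebra.lsmul k k _) (augmentedMul π hπ ε)

/-- As `ε x = 0`, `x` maps everything into `1 ⊗ A₂`; then `m` moves this into `ker π ⊗ A₂`, which
`x` kills. So each `x m x` acts as zero. -/
theorem augmentedRep_sandwichHom (π : A₁ →ₗ[k] k) (hπ : ∀ c : k, π (algebraMap k A₁ c) = c)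
    (ε : A₂ →ₐ[k] k) (x : A₂) (hx : ε x = 0) (t : TensorAlgebra k (LinearMap.ker π)) :
    augmentedRep π hπ ε (sandwichHom (LinearMap.ker π) x t) =
      algebraMap k _ (TensorAlgebra.algebraMapInv t) := by
  suffices h : (augmentedRep π hπ ε).comp (sandwichHom (LinearMap.ker π) x) =
      (Algebra.ofId k _).comp TensorAlgebra.algebraMapInv from DFunLike.congr_fun h t
  refine TensorAlgebra.hom_ext (LinearMap.ext fun m => LinearMap.ext fun u => ?_)
  have h : TensorAlgebra.algebraMapInv (TensorAlgebra.ι k m) = (0 : k) := by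
    simp [TensorAlgebra.algebraMapInv]
  simp [sandwichHom_ι, augmentedRep, AlgCoprod.lift_inl, AlgCoprod.lift_inr,
    augmentedMul_apply, hx, leftContract_smul_oneTensor, h]

theorem augmentedRep_comp_inl_injective (π : A₁ →ₗ[k] k)
    (hπ : ∀ c : k, π (algebraMap k A₁ c) = c) (ε : A₂ →ₐ[k] k) :
    Function.Injective (augmentedRep π hπ ε ∘ AlgCoprod.inl k A₁ A₂) := by
  intro a b h
  -- `a` sends `1 ⊗ 1` to `a ⊗ 1`, from which `id ⊗ ε` recovers `a`.
  have h := congrArg (TensorProduct.rid k A₁ ∘ TensorProduct.map LinearMap.id ε.toLinearMap)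
    (LinearMap.congr_fun h (1 ⊗ₜ 1))
  simpa [augmentedRep, AlgCoprod.lift_inl, TensorProduct.smul_tmul'] using h

theorem augmentedRep_comp_inr_injective (π : A₁ →ₗ[k] k)
    (hπ : ∀ c : k, π (algebraMap k A₁ c) = c) (ε : A₂ →ₐ[k] k) :
    Function.Injective (augmentedRep π hπ ε ∘ AlgCoprod.inr k A₁ A₂) := by
  intro a b h
  -- `b` sends `1 ⊗ 1` to `1 ⊗ b`, from which `π ⊗ id` recovers `b`.
  have h := congrArg (leftContract A₂ π) (LinearMap.congr_fun h (oneTensor k A₁ A₂ 1))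
  simpa [augmentedRep, AlgCoprod.lift_inr, augmentedMul_apply,
    leftContract_oneTensor π hπ] using h

end Action

/-! ### Freeness and ideal extension -/

section TensorIdeal

variable {k : Type*} [CommRing k]

theorem algebraMapInv_eq_zero_of_mem {M : Type*} [AddCommGroup M] [Module k M]
    {t : TensorAlgebra k M} (ht : t ∈ nonUnitalTensorAlgebra k M) :
    TensorAlgebra.algebraMapInv t = (0 : k) := by
  induction ht using NonUnitalAlgebra.adjoin_induction with
  | mem y hy =>
    obtain ⟨m, rfl⟩ := hy
    simp [TensorAlgebra.algebraMapInv]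
  | add y z _ _ hy hz => simp [hy, hz]
  | zero => simp
  | mul y z _ _ hy hz => simp [hy]
  | smul r y _ hy => simp [hy]

theorem sub_algebraMapInv_mem {M : Type*} [AddCommGroup M] [Module k M]
    (t : TensorAlgebra k M) :
    t - algebraMap k _ (TensorAlgebra.algebraMapInv t) ∈ nonUnitalTensorAlgebra k M := by
  induction t using TensorAlgebra.induction with
  | algebraMap r => simp [zero_mem]
  | ι m =>
    have h : TensorAlgebra.algebraMapInv (TensorAlgebra.ι k m) = (0 : k) := by
      simp [TensorAlgebra.algebraMapInv]
    rw [h, map_zero, sub_zero]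
    exact (nonUnitalTensorAlgebra.of k m).2
  | mul s t hs ht =>
    -- For `s = c + s'` and `t = d + t'` with constant terms `c`, `d`: `s t - c d = s' t' + c t' + d
    -- s'`.
    have h := add_mem (add_mem (mul_mem hs ht)
      (SMulMemClass.smul_mem (TensorAlgebra.algebraMapInv s : k) ht))
      (SMulMemClass.smul_mem (TensorAlgebra.algebraMapInv t : k) hs)
    convert h using 1
    simp only [Algebra.smul_def, map_mul, mul_sub, sub_mul,
      Algebra.commutes (TensorAlgebra.algebraMapInv t : k)]
    abel
  | add s t hs ht =>
    have h := add_mem hs ht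
    rwa [sub_add_sub_comm, ← map_add, ← map_add] at h

variable {A₁ : Type*} [Ring A₁] [Algebra k A₁] {A₂ : Type*} [Ring A₂] [Algebra k A₂]

theorem map_sandwichHom_nonUnitalTensorAlgebra (M : Submodule k A₁) (x : A₂) :
    (nonUnitalTensorAlgebra k M).map (sandwichHom M x) = sandwichSubalgebra M x := by
  rw [nonUnitalTensorAlgebra, NonUnitalAlgHom.map_adjoin, sandwichSubalgebra]
  congr 1
  ext b
  simp [sandwichSubmodule, sandwichHom]

/-- With the tensor algebra acting on itself by left multiplication, the action of `t` on `1 ⊗ 1` in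
the first summand recovers `t`. -/
theorem sandwichHom_injective (π : A₁ →ₗ[k] k) (hπ : ∀ c : k, π (algebraMap k A₁ c) = c)
    (ψ : A₂ →ₐ[k] Polynomial k ⧸ Ideal.span {(Polynomial.X : Polynomial k) ^ 3})
    (x : A₂) (hx : ψ x = Ideal.Quotient.mk _ (Polynomial.X : Polynomial k)) :
    Function.Injective (sandwichHom (LinearMap.ker π) x) := by
  rw [injective_iff_map_eq_zero]
  intro t ht
  have h := shiftRep_sandwichHom π hπ ψ x hx
    (Algebra.lmul k (TensorAlgebra k (LinearMap.ker π))) t (oneTensor k A₁ _ 1) 0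
  rw [ht, map_zero, LinearMap.zero_apply] at h
  simpa [leftContract_oneTensor π hπ] using
    (congrArg (leftContract (TensorAlgebra k (LinearMap.ker π)) π ∘ Prod.fst) h).symm

theorem sandwichSubalgebra_hasIdealExtensionProperty
    (π : A₁ →ₗ[k] k) (hπ : ∀ c : k, π (algebraMap k A₁ c) = c)
    (ψ : A₂ →ₐ[k] Polynomial k ⧸ Ideal.span {(Polynomial.X : Polynomial k) ^ 3})
    (x : A₂) (hx : ψ x = Ideal.Quotient.mk _ (Polynomial.X : Polynomial k)) :
    HasIdealExtensionProperty (sandwichSubalgebra (LinearMap.ker π) x) := by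
  intro I hI
  have hmem : ∀ t ∈ nonUnitalTensorAlgebra k (LinearMap.ker π),
      sandwichHom (LinearMap.ker π) x t ∈ sandwichSubalgebra (LinearMap.ker π) x := by
    intro t ht
    rw [← map_sandwichHom_nonUnitalTensorAlgebra]
    exact ⟨t, ht, rfl⟩
  -- The tensor algebra is `k` plus its nonunital part, so the pullback of `I` is a two-sided ideal
  -- of the whole tensor algebra.
  have hmul : ∀ r s, (∃ h : s ∈ nonUnitalTensorAlgebra k (LinearMap.ker π),
      (⟨_, hmem s h⟩ : sandwichSubalgebra (LinearMap.ker π) x) ∈ I) →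
      (∃ h : r * s ∈ nonUnitalTensorAlgebra k (LinearMap.ker π),
        (⟨_, hmem _ h⟩ : sandwichSubalgebra (LinearMap.ker π) x) ∈ I) ∧
      (∃ h : s * r ∈ nonUnitalTensorAlgebra k (LinearMap.ker π),
        (⟨_, hmem _ h⟩ : sandwichSubalgebra (LinearMap.ker π) x) ∈ I) := by
    rintro r s ⟨hs, hsI⟩
    obtain ⟨c, r', hr', rfl⟩ : ∃ (c : k) (r' : TensorAlgebra k (LinearMap.ker π)),
        r' ∈ nonUnitalTensorAlgebra k (LinearMap.ker π) ∧ algebraMap k _ c + r' = r :=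
      ⟨_, _, sub_algebraMapInv_mem r, add_sub_cancel _ _⟩
    constructor
    · refine ⟨?_, ?_⟩
      · rw [add_mul, ← Algebra.smul_def]
        exact add_mem (SMulMemClass.smul_mem c hs) (mul_mem hr' hs)
      · convert add_mem (I.smul_mem c hsI) (hI ⟨_, hmem r' hr'⟩ _ hsI).1 using 1
        ext
        simp [add_mul, Algebra.smul_def]
    · refine ⟨?_, ?_⟩
      · rw [mul_add, ← Algebra.commutes, ← Algebra.smul_def]
        exact add_mem (SMulMemClass.smul_mem c hs) (mul_mem hs hr')
      · convert add_mem (I.smul_mem c hsI) (hI ⟨_, hmem r' hr'⟩ _ hsI).2 using 1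
        ext
        simp [mul_add, Algebra.smul_def, Algebra.commutes]
  let I' : Submodule (TensorAlgebra k (LinearMap.ker π)) (TensorAlgebra k (LinearMap.ker π)) :=
    { carrier := {t | ∃ h : t ∈ nonUnitalTensorAlgebra k (LinearMap.ker π),
        (⟨_, hmem t h⟩ : sandwichSubalgebra (LinearMap.ker π) x) ∈ I}
      add_mem' := by
        rintro s t ⟨hs, hsI⟩ ⟨ht, htI⟩
        refine ⟨add_mem hs ht, ?_⟩
        convert add_mem hsI htI using 1
        ext
        simp
      zero_mem' := by
        refine ⟨zero_mem _, ?_⟩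
        convert zero_mem I
        exact map_zero _
      smul_mem' := fun r s hs => (hmul r s hs).1 }
  let F : TensorAlgebra k (LinearMap.ker π) →ₐ[k]
      Module.End k (TensorAlgebra k (LinearMap.ker π) ⧸ I') := Algebra.lsmul k k _
  let ρ := shiftRep π hπ ψ (F.toLinearMap ∘ₗ TensorAlgebra.ι k)
  refine ⟨LinearMap.ker ρ.toLinearMap, ?_, ?_⟩
  · intro r b hb
    simp only [LinearMap.mem_ker, AlgHom.toLinearMap_apply] at hb ⊢
    simp [hb]
  · rintro ⟨a, ha⟩
    obtain ⟨t, ht, rfl⟩ : ∃ t ∈ nonUnitalTensorAlgebra k (LinearMap.ker π),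
        sandwichHom (LinearMap.ker π) x t = a := by
      rw [← map_sandwichHom_nonUnitalTensorAlgebra] at ha
      exact ha
    have hact := shiftRep_sandwichHom π hπ ψ x hx F t
    rw [algebraMapInv_eq_zero_of_mem ht] at hact
    have hF : ∀ s : TensorAlgebra k (LinearMap.ker π),
        F t (Submodule.Quotient.mk s) = Submodule.Quotient.mk (t * s) := fun s => rfl
    simp only [LinearMap.mem_ker, AlgHom.toLinearMap_apply]
    constructor
    · intro htI
      refine LinearMap.ext fun ⟨u, v⟩ => ?_
      -- Absorption on the right makes `t` annihilate the quotient; its action on the complement is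
      -- zero because its constant term is.
      have h0 : ∀ n, F t n = 0 := by
        intro n
        obtain ⟨s, rfl⟩ := Submodule.Quotient.mk_surjective I' n
        rw [hF]
        exact (Submodule.Quotient.mk_eq_zero I').2 (hmul s t ⟨ht, htI⟩).2
      rw [hact, h0]
      simp
    · intro h
      -- The class of `1` detects membership: `t` kills it only if `t ∈ I'`.
      have h1 := hact (oneTensor k A₁ _ (Submodule.Quotient.mk 1)) 0
      erw [h] at h1
      have h2 : F t (Submodule.Quotient.mk 1) = 0 := by
        simpa [leftContract_oneTensor π hπ] using
          (congrArg (leftContract _ π ∘ Prod.fst) h1).symm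
      rw [hF, mul_one] at h2
      exact ((Submodule.Quotient.mk_eq_zero I').1 h2).2

/-- Both coprojections factor through the subalgebra they generate, so by the universal property the
identity does too. -/
theorem AlgCoprod.adjoin_range_inl_union_range_inr :
    Algebra.adjoin k (Set.range (AlgCoprod.inl k A₁ A₂) ∪ Set.range (AlgCoprod.inr k A₁ A₂)) =
      ⊤ := by
  set C := Algebra.adjoin k
    (Set.range (AlgCoprod.inl k A₁ A₂) ∪ Set.range (AlgCoprod.inr k A₁ A₂))
  let f : A₁ →ₐ[k] C := (AlgCoprod.inl k A₁ A₂).codRestrict C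
    fun a => Algebra.subset_adjoin (Or.inl ⟨a, rfl⟩)
  let g : A₂ →ₐ[k] C := (AlgCoprod.inr k A₁ A₂).codRestrict C
    fun a => Algebra.subset_adjoin (Or.inr ⟨a, rfl⟩)
  have h : C.val.comp (AlgCoprod.lift (k := k) (C := C) f g) = AlgHom.id k _ :=
    AlgCoprod.hom_ext (fun a => by simp [AlgCoprod.lift_inl, f])
      (fun a => by simp [AlgCoprod.lift_inr, g])
  rw [eq_top_iff]
  intro b _
  have hb := DFunLike.congr_fun h b
  rw [AlgHom.id_apply] at hb
  rw [← hb]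
  exact (AlgCoprod.lift (k := k) (C := C) f g b).2

end TensorIdeal

/-! ### Embedding `A₀` in an algebra generated by `A₁` and `A₂` -/

/-- The relations in the coproduct which kill the image under `sandwichHom` of the kernel
of `F`. -/
def sandwichRel {k : Type*} [CommRing k] {A₁ : Type*} [Ring A₁] [Algebra k A₁]
    {A₂ : Type*} [Ring A₂] [Algebra k A₂] {A₀ : Type*} [Ring A₀] [Algebra k A₀]
    (M : Submodule k A₁) (x : A₂) (F : TensorAlgebra k M →ₐ[k] A₀)
    (b c : AlgCoprod k A₁ A₂) : Prop :=
  ∃ t, F t = 0 ∧ b = sandwichHom M x t ∧ c = 0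

theorem exists_overalgebra {k : Type u} [CommRing k]
    {A₁ : Type v} [Ring A₁] [Algebra k A₁] {A₂ : Type w} [Ring A₂] [Algebra k A₂]
    (π : A₁ →ₗ[k] k) (hπ : ∀ c : k, π (algebraMap k A₁ c) = c)
    (ψ : A₂ →ₐ[k] Polynomial k ⧸ Ideal.span {(Polynomial.X : Polynomial k) ^ 3})
    (x : A₂) (hx : ψ x = Ideal.Quotient.mk _ (Polynomial.X : Polynomial k))
    (A₀ : Type z) [Ring A₀] [Algebra k A₀] (ε : A₀ →ₐ[k] k)
    (φ : LinearMap.ker π →ₗ[k] A₀) (hφ : Algebra.adjoin k (Set.range φ) = ⊤) :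
    ∃ (R : Type (max u v w)) (_ : Ring R) (_ : Algebra k R)
      (f₀ : A₀ →ₐ[k] R) (f₁ : A₁ →ₐ[k] R) (f₂ : A₂ →ₐ[k] R),
      Function.Injective f₀ ∧ Function.Injective f₁ ∧ Function.Injective f₂ ∧
      Algebra.adjoin k (Set.range f₁ ∪ Set.range f₂) = ⊤ := by
  -- Subtracting scalars puts the generators in the kernel of `ε` without changing the unital
  -- algebra generated. Then `ε ∘ F` is the augmentation, so `ker F` has zero constant terms and
  -- both representations descend to the quotient.
  let φ' : LinearMap.ker π →ₗ[k] A₀ := φ - Algebra.linearMap k A₀ ∘ₗ ε.toLinearMap ∘ₗ φ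
  have hφ' : ∀ m, φ' m = φ m - algebraMap k A₀ (ε (φ m)) := fun m => rfl
  let F : TensorAlgebra k (LinearMap.ker π) →ₐ[k] A₀ := TensorAlgebra.lift k φ'
  have hF : Function.Surjective F := by
    rw [← AlgHom.range_eq_top, eq_top_iff, ← hφ]
    refine Algebra.adjoin_le ?_
    rintro _ ⟨m, rfl⟩
    refine ⟨TensorAlgebra.ι k m + algebraMap k _ (ε (φ m)), ?_⟩
    simp [F, hφ']
  have hε : ∀ t, ε (F t) = TensorAlgebra.algebraMapInv t := by
    suffices h : ε.comp F = TensorAlgebra.algebraMapInv from DFunLike.congr_fun h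
    refine TensorAlgebra.hom_ext (LinearMap.ext fun m => ?_)
    simp [F, hφ', TensorAlgebra.algebraMapInv]
  let q := RingQuot.mkAlgHom k (sandwichRel (LinearMap.ker π) x F)
  have hq : ∀ t, F t = 0 → q (sandwichHom (LinearMap.ker π) x t) = 0 := by
    intro t ht
    have h := RingQuot.mkAlgHom_rel k
      (show sandwichRel (LinearMap.ker π) x F _ _ from ⟨t, ht, rfl, rfl⟩)
    rwa [map_zero] at h
  let L : TensorAlgebra k (LinearMap.ker π) →ₐ[k] Module.End k A₀ := (Algebra.lmul k A₀).comp F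
  let ρ := RingQuot.liftAlgHom k (s := sandwichRel (LinearMap.ker π) x F)
    ⟨shiftRep π hπ ψ (L.toLinearMap ∘ₗ TensorAlgebra.ι k), by
      rintro _ _ ⟨t, ht, rfl, rfl⟩
      refine LinearMap.ext fun ⟨u, v⟩ => ?_
      rw [shiftRep_sandwichHom π hπ ψ x hx L, ← hε]
      simp [L, ht]⟩
  have hρ : ∀ b, ρ (q b) = shiftRep π hπ ψ (L.toLinearMap ∘ₗ TensorAlgebra.ι k) b :=
    fun b => RingQuot.liftAlgHom_mkAlgHom_apply ..
  -- The augmentation of `A₂` is `ψ` followed by evaluation at `X = 0`.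
  let ε₂ : A₂ →ₐ[k] k := (truncatedAeval 0 (by simp)).comp ψ
  have hε₂ : ε₂ x = 0 := by simp [ε₂, hx, truncatedAeval_mk_X]
  let σ := RingQuot.liftAlgHom k (s := sandwichRel (LinearMap.ker π) x F)
    ⟨augmentedRep π hπ ε₂, by
      rintro _ _ ⟨t, ht, rfl, rfl⟩
      rw [augmentedRep_sandwichHom π hπ ε₂ x hε₂, ← hε, ht]
      simp⟩
  have hσ : ∀ b, σ (q b) = augmentedRep π hπ ε₂ b :=
    fun b => RingQuot.liftAlgHom_mkAlgHom_apply ..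
  -- `A₀` is identified with the tensor algebra modulo `ker F`, on which the map to the quotient is
  -- well defined.
  let f₀ : A₀ →ₐ[k] RingQuot (sandwichRel (LinearMap.ker π) x F) :=
    (Ideal.Quotient.liftₐ (RingHom.ker F) (q.comp (sandwichHom (LinearMap.ker π) x))
      (fun t ht => hq t ht)).comp (Ideal.quotientKerAlgEquivOfSurjective hF).symm.toAlgHom
  have hf₀ : ∀ t, f₀ (F t) = q (sandwichHom (LinearMap.ker π) x t) := by
    intro t
    have h : (Ideal.quotientKerAlgEquivOfSurjective hF).symm (F t) = Ideal.Quotient.mk _ t := by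
      rw [AlgEquiv.symm_apply_eq]
      rfl
    simp only [f₀, AlgHom.comp_apply, AlgEquiv.coe_toAlgHom, h]
    rfl
  refine ⟨RingQuot (sandwichRel (LinearMap.ker π) x F), inferInstance, inferInstance, f₀,
    q.comp (AlgCoprod.inl k A₁ A₂), q.comp (AlgCoprod.inr k A₁ A₂), ?_, ?_, ?_, ?_⟩
  · rw [injective_iff_map_eq_zero]
    intro a ha
    obtain ⟨t, rfl⟩ := hF a
    have h := shiftRep_sandwichHom π hπ ψ x hx L t (oneTensor k A₁ _ 1) 0
    rw [← hρ, ← hf₀, ha, map_zero, LinearMap.zero_apply] at h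
    simpa [leftContract_oneTensor π hπ, L] using
      (congrArg (leftContract A₀ π ∘ Prod.fst) h).symm
  · refine fun a b h => augmentedRep_comp_inl_injective π hπ ε₂ ?_
    have h := congrArg σ h
    rwa [AlgHom.comp_apply, AlgHom.comp_apply, hσ, hσ] at h
  · refine fun a b h => augmentedRep_comp_inr_injective π hπ ε₂ ?_
    have h := congrArg σ h
    rwa [AlgHom.comp_apply, AlgHom.comp_apply, hσ, hσ] at h
  · have h := congrArg (Subalgebra.map q)
      (AlgCoprod.adjoin_range_inl_union_range_inr (k := k) (A₁ := A₁) (A₂ := A₂))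
    rw [AlgHom.map_adjoin, Set.image_union, ← Set.range_comp, ← Set.range_comp,
      Algebra.map_top, (AlgHom.range_eq_top q).2 (RingQuot.mkAlgHom_surjective k _)] at h
    exact h

theorem theoremT {k : Type u} [CommRing k]
    {A₁ : Type v} [Ring A₁] [Algebra k A₁] {A₂ : Type w} [Ring A₂] [Algebra k A₂]
    (π : A₁ →ₗ[k] k) (hπ : ∀ c : k, π (algebraMap k A₁ c) = c)
    (ψ : A₂ →ₐ[k] Polynomial k ⧸ Ideal.span {(Polynomial.X : Polynomial k) ^ 3})
    (hψ : Function.Surjective ψ)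
    (x : A₂) (hx : ψ x = Ideal.Quotient.mk _ (Polynomial.X : Polynomial k)) :
    (∃ e : LinearMap.ker π ≃ₗ[k] sandwichSubmodule (LinearMap.ker π) x,
      ∀ m : LinearMap.ker π, (e m : AlgCoprod k A₁ A₂) =
        AlgCoprod.inr k A₁ A₂ x * AlgCoprod.inl k A₁ A₂ m * AlgCoprod.inr k A₁ A₂ x) ∧
    (∃ Φ : nonUnitalTensorAlgebra k (LinearMap.ker π) →ₙₐ[k]
        sandwichSubalgebra (LinearMap.ker π) x,
      Function.Bijective Φ ∧
      ∀ m : LinearMap.ker π, (Φ (nonUnitalTensorAlgebra.of k m) : AlgCoprod k A₁ A₂) =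
        AlgCoprod.inr k A₁ A₂ x * AlgCoprod.inl k A₁ A₂ m * AlgCoprod.inr k A₁ A₂ x) ∧
    HasIdealExtensionProperty (sandwichSubalgebra (LinearMap.ker π) x) ∧
    ∀ (A₀ : Type z) [Ring A₀] [Algebra k A₀],
      Nonempty (A₀ →ₐ[k] k) →
      (∃ φ : LinearMap.ker π →ₗ[k] A₀, Algebra.adjoin k (Set.range φ) = ⊤) →
      ∃ (R : Type (max u v w)) (_ : Ring R) (_ : Algebra k R)
        (f₀ : A₀ →ₐ[k] R) (f₁ : A₁ →ₐ[k] R) (f₂ : A₂ →ₐ[k] R),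
        Function.Injective f₀ ∧ Function.Injective f₁ ∧ Function.Injective f₂ ∧
        Algebra.adjoin k (Set.range f₁ ∪ Set.range f₂) = ⊤ := by
  have hinj := sandwichHom_injective π hπ ψ x hx
  refine ⟨?_, ?_, sandwichSubalgebra_hasIdealExtensionProperty π hπ ψ x hx,
    fun A₀ _ _ ⟨ε⟩ ⟨φ, hφ⟩ => exists_overalgebra π hπ ψ x hx A₀ ε φ hφ⟩
  · have hmem : ∀ m : LinearMap.ker π,
        ((sandwichHom (LinearMap.ker π) x).toLinearMap ∘ₗ TensorAlgebra.ι k) m ∈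
          sandwichSubmodule (LinearMap.ker π) x :=
      fun m => ⟨_, ⟨m, m.2, rfl⟩, by simp [sandwichHom]⟩
    refine ⟨LinearEquiv.ofBijective (LinearMap.codRestrict _ _ hmem) ⟨?_, ?_⟩, fun m => ?_⟩
    · exact fun m n h => TensorAlgebra.ι_leftInverse.injective
        (hinj (congrArg Subtype.val h))
    · rintro ⟨_, _, ⟨m, hm, rfl⟩, rfl⟩
      exact ⟨⟨m, hm⟩, Subtype.ext (by simp [sandwichHom])⟩
    · exact sandwichHom_ι _ x m
  · have hmem : ∀ t : nonUnitalTensorAlgebra k (LinearMap.ker π),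
        ((sandwichHom (LinearMap.ker π) x : _ →ₙₐ[k] AlgCoprod k A₁ A₂).comp
          (NonUnitalSubalgebraClass.subtype _)) t ∈ sandwichSubalgebra (LinearMap.ker π) x := by
      intro t
      rw [← map_sandwichHom_nonUnitalTensorAlgebra]
      exact ⟨t, t.2, rfl⟩
    refine ⟨NonUnitalAlgHom.codRestrict _ _ hmem, ⟨?_, ?_⟩, fun m => sandwichHom_ι _ x m⟩
    · rw [NonUnitalAlgHom.injective_codRestrict]
      exact hinj.comp Subtype.val_injective
    · rintro ⟨a, ha⟩
      obtain ⟨t, ht, rfl⟩ : a ∈ (nonUnitalTensorAlgebra k (LinearMap.ker π)).map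
          (sandwichHom (LinearMap.ker π) x) := by
        rwa [map_sandwichHom_nonUnitalTensorAlgebra]
      exact ⟨⟨t, ht⟩, rfl⟩
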